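/- Let $\mathcal{O}$ be a Noetherian integrally closed domain with field of fractions $K$, and let $A$ be an $\mathcal{O}$-algebra which is free and finitely generated as an $\mathcal{O}$-module. A symmetrizing form on $A$ is an $\mathcal{O}$-linear map $t : A \to \mathcal{O}$ with $t(ab)=t(ba)$ such that $a \mapsto (x \mapsto t(ax))$ is an isomorphism $A \to \mathrm{Hom}_{\mathcal{O}}(A,\mathcal{O})$. Let $t$ be a symmetrizing form on $A$, let $G$ be a finite cyclic group, and let $(A,t)$ be a twisted symmetric algebra of $G$ over a subalgebra $\bar A$; that is: (i) $\bar A$ is free of finite rank over $\mathcal{O}$, $t|_{\bar A}$ is a symmetrizing form on $\bar A$, and $A$ is free of finite rank as a left $\bar A$-module; (ii) there are given $\mathcal{O}$-submodules $(A_g)_{g\in G}$ of $A$ with $A=\bigoplus_{g\in G}A_g$, $A_gA_h=A_{gh}$ for all $g,h \in G$, $A_1=\bar A$, $t(A_g)=0$ for $g\neq 1$, and $A_g\cap A^\times\neq\emptyset$ for all $g \in G$. Assume that the algebras $KA=K\otimes_{\mathcal{O}}A$, $K\bar A=K\otimes_{\mathcal{O}}\bar A$ and $KG$ are split semisimple over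 $K$ (semisimple, with $\mathrm{End}(V)\simeq K$ for every simple module $V$). For a ring $R$ with center $ZR$, a block of $R$ is a primitive idempotent of $ZR$, i.e. a non-zero central idempotent which is not a sum of two non-zero orthogonal central idempotents; $\mathrm{Bl}(R)$ is the set of blocks of $R$. The group $G$ acts on $Z\bar A$ by ring automorphisms, $g(\bar a)$ being the unique element with $g(\bar a)x=x\bar a$ for all $x\in A_g$, and hence on $\mathrm{Bl}(\bar A)$. The group $G^\vee=\mathrm{Hom}(G,K^\times)$, whose elements take values in $\mathcal{O}^\times$, acts on $A$ by algebra automorphisms, $\xi\cdot x=\xi(g)x$ for $x\in A_g$, and hence on $\mathrm{Bl}(A)$. For $\bar b\in\mathrm{Bl}(\bar A)$ and $b\in\mathrm{Bl}(A)$, with stabilizers $G_{\bar b}$ and $(G^\vee)_b$, put $$\mathrm{Tr}(G,\bar b)=\sum_{g\in G/G_{\bar b}}g(\bar b),\qquad \mathrm{Tr}(G^\vee,b)=\sum_{\xi\in G^\vee/(G^\vee)_b}\xi\cdot b .$$ Then: (1) There is a bijection $\mathrm{Bl}(\bar A)/G\leftrightarrow\mathrm{Bl}(A)/G^\vee$,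 $\bar{\mathcal{Y}}\leftrightarrow\mathcal{Y}$, between orbit sets such that $\sum_{\bar b\in\bar{\mathcal{Y}}}\bar b=\sum_{b\in\mathcal{Y}}b$, i.e. $\mathrm{Tr}(G,\bar b)=\mathrm{Tr}(G^\vee,b)$ for all $\bar b\in\bar{\mathcal{Y}}$ and $b\in\mathcal{Y}$. (2) The algebras $(Z\bar A)^G$ and $(ZA)^{G^\vee}$ have the same blocks (as elements of $A$). (3) If every block of $A$ is fixed by $G^\vee$, then the blocks of $A$ coincide with the blocks of $(Z\bar A)^G$. -/

import Mathlib

open scoped TensorProduct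

/-- A block (block-idempotent) of `R`: a non-zero central idempotent which is not the sum of two
non-zero orthogonal central idempotents. -/
structure IsBlock {R : Type*} [Semiring R] (e : R) : Prop where
  idem : e * e = e
  central : e ∈ Set.center R
  ne_zero : e ≠ 0
  primitive : ∀ e₁ e₂ : R, e₁ ∈ Set.center R → e₂ ∈ Set.center R → e₁ * e₁ = e₁ → e₂ * e₂ = e₂ →
    e₁ * e₂ = 0 → e = e₁ + e₂ → e₁ = 0 ∨ e₂ = 0

/-- A `K`-algebra `B` is split semisimple if it is semisimple and `End_B(V) ≃ K` for every simple
`B`-module `V`. (Every simple module is a quotient of `B`, so the universe of `B` suffices.) -/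
def IsSplitSemisimple.{u, v} (K : Type u) [Field K] (B : Type v) [Ring B] [Algebra K B] : Prop :=
  IsSemisimpleRing B ∧
    ∀ (V : Type v) [AddCommGroup V] [Module K V] [Module B V] [IsScalarTower K B V]
      [IsSimpleModule B V], Nonempty (Module.End B V ≃ₐ[K] K)

/-- A symmetrizing form: a trace function `t` such that `a ↦ (x ↦ t (a x))` is an isomorphism from
`A` to its `O`-dual. (This map is a morphism of bimodules for every trace function `t`.) -/
structure IsSymmetrizingForm {O A : Type*} [CommRing O] [Ring A] [Algebra O A]
    (t : A →ₗ[O] O) : Prop where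
  trace : ∀ a b : A, t (a * b) = t (b * a)
  bijective : Function.Bijective fun a : A => t ∘ₗ LinearMap.mulLeft O a

/-- `S` is a symmetric subalgebra of `(A, t)`. -/
structure IsSymmetricSubalgebra {O A : Type*} [CommRing O] [Ring A] [Algebra O A]
    (t : A →ₗ[O] O) (S : Subalgebra O A) : Prop where
  free : Module.Free O S
  finite : Module.Finite O S
  form : IsSymmetrizingForm (t ∘ₗ S.val.toLinearMap)
  free_left : Module.Free S A
  finite_left : Module.Finite S A

/-- The structure of a twisted symmetric algebra of the group `G` on the `O`-algebra `A`:
a symmetrizing form `t`, the subalgebra `bar` (written `Ā` below), and the family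
`comp g = A_g` of submodules. -/
structure TwistedSymmetricAlgebra (O G A : Type*) [CommRing O] [Group G] [DecidableEq G]
    [Ring A] [Algebra O A] where
  t : A →ₗ[O] O
  symmetrizing : IsSymmetrizingForm t
  bar : Subalgebra O A
  symmetric_bar : IsSymmetricSubalgebra t bar
  comp : G → Submodule O A
  internal : DirectSum.IsInternal comp
  comp_mul : ∀ g h : G, comp g * comp h = comp (g * h)
  comp_one : comp 1 = Subalgebra.toSubmodule bar
  t_comp : ∀ g : G, g ≠ 1 → ∀ a ∈ comp g, t a = 0
  exists_unit : ∀ g : G, ∃ u : Aˣ, (u : A) ∈ comp g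

/-- The value of a character `ξ : G → Kˣ` of a finite group lies in `O` if `O` is integrally closed
in `K`. -/
theorem exists_charVal {O K G : Type*} [CommRing O] [IsIntegrallyClosed O] [Field K]
    [Algebra O K] [IsFractionRing O K] [Group G] [Finite G] (ξ : G →* Kˣ) (g : G) :
    ∃ c : O, algebraMap O K c = (ξ g : K) := by
  apply IsIntegrallyClosed.isIntegral_iff.mp
  have h : ((ξ g : Kˣ) : K) ^ Nat.card G = 1 := by
    rw [← Units.val_pow_eq_pow_val, ← map_pow, pow_card_eq_one']
    simp
  exact IsIntegral.of_pow Nat.card_pos (h ▸ isIntegral_one)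

/-- The element of `O` whose image in `K` is `ξ g`. -/
noncomputable def charVal (O : Type*) {K G : Type*} [CommRing O] [IsIntegrallyClosed O] [Field K]
    [Algebra O K] [IsFractionRing O K] [Group G] [Finite G] (ξ : G →* Kˣ) (g : G) : O :=
  (exists_charVal (O := O) ξ g).choose

theorem algebraMap_charVal {O K G : Type*} [CommRing O] [IsIntegrallyClosed O] [Field K]
    [Algebra O K] [IsFractionRing O K] [Group G] [Finite G] (ξ : G →* Kˣ) (g : G) :
    algebraMap O K (charVal O ξ g) = (ξ g : K) :=
  (exists_charVal (O := O) ξ g).choose_spec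

section CharVal

variable {O K G : Type*} [CommRing O] [IsIntegrallyClosed O] [Field K] [Algebra O K]
  [IsFractionRing O K] [Group G] [Finite G]

theorem charVal_mul (ξ : G →* Kˣ) (g h : G) :
    charVal O ξ (g * h) = charVal O ξ g * charVal O ξ h := by
  apply IsFractionRing.injective O K
  simp [algebraMap_charVal]

theorem charVal_one (ξ : G →* Kˣ) : charVal O ξ 1 = 1 := by
  apply IsFractionRing.injective O K
  simp [algebraMap_charVal]

theorem charVal_mul_char (ξ ψ : G →* Kˣ) (g : G) :
    charVal O (ξ * ψ) g = charVal O ξ g * charVal O ψ g := by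
  apply IsFractionRing.injective O K
  simp [algebraMap_charVal]

theorem charVal_one_char (g : G) : charVal O (1 : G →* Kˣ) g = 1 := by
  apply IsFractionRing.injective O K
  simp [algebraMap_charVal]

end CharVal

namespace TwistedSymmetricAlgebra

section Bar

variable {O G A : Type*} [CommRing O] [Group G] [DecidableEq G] [Ring A] [Algebra O A]
  (D : TwistedSymmetricAlgebra O G A)

theorem mem_comp_one {a : A} : a ∈ D.comp 1 ↔ a ∈ D.bar := by
  rw [D.comp_one, Subalgebra.mem_toSubmodule]

theorem mul_mem_comp {g h : G} {a b : A} (ha : a ∈ D.comp g) (hb : b ∈ D.comp h) :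
    a * b ∈ D.comp (g * h) := by
  rw [← D.comp_mul]
  exact Submodule.mul_mem_mul ha hb

theorem inv_mem_comp {g : G} {u : Aˣ} (hu : (u : A) ∈ D.comp g) :
    ((u⁻¹ : Aˣ) : A) ∈ D.comp g⁻¹ := by
  let 𝒜 : Additive G → Submodule O A := fun i => D.comp i.toMul
  let : DecidableEq (Additive G) := inferInstanceAs (DecidableEq G)
  have hI : DirectSum.IsInternal 𝒜 := D.internal
  let : DirectSum.Decomposition 𝒜 := hI.chooseDecomposition
  let : GradedRing 𝒜 :=
    { one_mem := (D.mem_comp_one).2 D.bar.one_mem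
      mul_mem := fun _ _ _ _ ha hb => D.mul_mem_comp ha hb }
  let i : Additive G := Additive.ofMul g
  have hu' : (u : A) ∈ 𝒜 i := hu
  have h1 : (1 : A) ∈ 𝒜 (i + -i) := by
    rw [add_neg_cancel]
    exact SetLike.GradedOne.one_mem
  have key := DirectSum.coe_decompose_mul_add_of_left_mem 𝒜 (i := i) (j := -i)
    (b := ((u⁻¹ : Aˣ) : A)) hu'
  rw [Units.mul_inv, DirectSum.decompose_of_mem_same 𝒜 h1] at key
  have : ((u⁻¹ : Aˣ) : A) = DirectSum.decompose 𝒜 ((u⁻¹ : Aˣ) : A) (-i) :=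
    Units.inv_eq_of_mul_eq_one_right key.symm
  rw [this]
  exact (DirectSum.decompose 𝒜 ((u⁻¹ : Aˣ) : A) (-i)).2

theorem exists_act (g : G) (z : Subalgebra.center O D.bar) :
    ∃ y : Subalgebra.center O D.bar, ∀ x ∈ D.comp g,
      ((y : D.bar) : A) * x = x * ((z : D.bar) : A) := by
  obtain ⟨u, hu⟩ := D.exists_unit g
  have hu' := D.inv_mem_comp hu
  have hz : ∀ w ∈ D.bar, w * ((z : D.bar) : A) = ((z : D.bar) : A) * w := fun w hw =>
    congrArg Subtype.val (Subalgebra.mem_center_iff.1 z.2 ⟨w, hw⟩)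
  have hy : (u : A) * ((z : D.bar) : A) * ((u⁻¹ : Aˣ) : A) ∈ D.bar := by
    rw [← D.mem_comp_one]
    have := D.mul_mem_comp (D.mul_mem_comp hu ((D.mem_comp_one).2 (z : D.bar).2)) hu'
    simpa using this
  refine ⟨⟨⟨_, hy⟩, Subalgebra.mem_center_iff.2 fun w => Subtype.ext ?_⟩, fun x hx => ?_⟩
  · have hw : ((u⁻¹ : Aˣ) : A) * w * u ∈ D.bar := by
      rw [← D.mem_comp_one]
      have := D.mul_mem_comp (D.mul_mem_comp hu' ((D.mem_comp_one).2 w.2)) hu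
      simpa using this
    have := congrArg (fun a => (u : A) * a * ((u⁻¹ : Aˣ) : A)) (hz _ hw)
    simpa [mul_assoc] using this
  · have hx' : ((u⁻¹ : Aˣ) : A) * x ∈ D.bar := by
      rw [← D.mem_comp_one]
      simpa using D.mul_mem_comp hu' hx
    have := congrArg (fun a => (u : A) * a) (hz _ hx')
    simpa [mul_assoc] using this.symm

theorem comp_induction {p : A → Prop} (h0 : p 0) (hadd : ∀ a b, p a → p b → p (a + b))
    (hc : ∀ g, ∀ a ∈ D.comp g, p a) (a : A) : p a := by
  have ha : a ∈ ⨆ g, D.comp g := by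
    rw [D.internal.submodule_iSup_eq_top]
    trivial
  exact Submodule.iSup_induction D.comp (motive := p) ha hc h0 hadd

/-- For `z ∈ ZĀ`, the unique element `g(z)` with `g(z) x = x z` for all `x ∈ A_g`. -/
noncomputable def act (g : G) (z : Subalgebra.center O D.bar) : Subalgebra.center O D.bar :=
  (D.exists_act g z).choose

theorem act_mul {g : G} (z : Subalgebra.center O D.bar) {x : A} (hx : x ∈ D.comp g) :
    ((D.act g z : D.bar) : A) * x = x * ((z : D.bar) : A) :=
  (D.exists_act g z).choose_spec x hx

theorem act_unique {g : G} {z y : Subalgebra.center O D.bar} {u : Aˣ}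
    (hu : (u : A) ∈ D.comp g) (h : ((y : D.bar) : A) * u = u * ((z : D.bar) : A)) :
    D.act g z = y := by
  apply Subtype.ext
  apply Subtype.ext
  exact u.isUnit.mul_right_cancel ((D.act_mul z hu).trans h.symm)

/-- The action of `G` on `ZĀ` by ring automorphisms. -/
noncomputable instance : MulSemiringAction G (Subalgebra.center O D.bar) where
  smul := D.act
  one_smul z := by
    refine D.act_unique (u := 1) ((D.mem_comp_one).2 D.bar.one_mem) ?_
    simp
  mul_smul g h z := by
    obtain ⟨u, hu⟩ := D.exists_unit g
    obtain ⟨v, hv⟩ := D.exists_unit h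
    refine D.act_unique (u := u * v) (D.mul_mem_comp hu hv) ?_
    change ((D.act g (D.act h z) : D.bar) : A) * _ = _
    rw [Units.val_mul, ← mul_assoc, D.act_mul _ hu, mul_assoc, D.act_mul _ hv, mul_assoc]
  smul_zero g := by
    obtain ⟨u, hu⟩ := D.exists_unit g
    exact D.act_unique hu (by simp)
  smul_add g x y := by
    obtain ⟨u, hu⟩ := D.exists_unit g
    refine D.act_unique hu ?_
    change (((D.act g x + D.act g y : Subalgebra.center O D.bar) : D.bar) : A) * _ = _
    simp [add_mul, mul_add, D.act_mul _ hu]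
  smul_one g := by
    obtain ⟨u, hu⟩ := D.exists_unit g
    exact D.act_unique hu (by simp)
  smul_mul g x y := by
    obtain ⟨u, hu⟩ := D.exists_unit g
    refine D.act_unique hu ?_
    change (((D.act g x * D.act g y : Subalgebra.center O D.bar) : D.bar) : A) * _ = _
    rw [mul_comm (D.act g x)]
    simp only [MulMemClass.coe_mul]
    rw [mul_assoc, D.act_mul _ hu, ← mul_assoc, D.act_mul _ hu, mul_assoc,
      ← MulMemClass.coe_mul, ← MulMemClass.coe_mul, ← MulMemClass.coe_mul,
      ← MulMemClass.coe_mul, mul_comm]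

/-- The subalgebra `(ZĀ)^G` of `ZĀ`. -/
def fixedBar : Subalgebra O (Subalgebra.center O D.bar) where
  carrier := {z | ∀ g : G, g • z = z}
  mul_mem' hx hy g := by rw [smul_mul', hx g, hy g]
  add_mem' hx hy g := by rw [smul_add, hx g, hy g]
  algebraMap_mem' r g := by
    obtain ⟨u, hu⟩ := D.exists_unit g
    exact D.act_unique hu (Algebra.commutes r (u : A))

/-- `Bl(Ā)`. -/
def BarBlocks : Type _ := {b : D.bar // IsBlock b}

end Bar

end TwistedSymmetricAlgebra

/-- A block of `R`, seen in the center, is a primitive idempotent there; so ring automorphisms of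
the center permute the blocks. -/
theorem IsBlock.map_center {O R : Type*} [CommRing O] [Ring R] [Algebra O R]
    (σ : Subalgebra.center O R ≃+* Subalgebra.center O R) {b : R} (hb : IsBlock b)
    (hc : b ∈ Subalgebra.center O R) : IsBlock (σ ⟨b, hc⟩ : R) where
  idem := by
    have : (⟨b, hc⟩ : Subalgebra.center O R) * ⟨b, hc⟩ = ⟨b, hc⟩ := Subtype.ext hb.idem
    rw [← MulMemClass.coe_mul, ← map_mul, this]
  central := (σ ⟨b, hc⟩).2
  ne_zero h := by
    have h0 : σ ⟨b, hc⟩ = 0 := Subtype.ext h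
    rw [map_eq_zero_iff σ σ.injective] at h0
    exact hb.ne_zero (congrArg Subtype.val h0)
  primitive e₁ e₂ h₁ h₂ i₁ i₂ o s := by
    let f₁ : Subalgebra.center O R := ⟨e₁, h₁⟩
    let f₂ : Subalgebra.center O R := ⟨e₂, h₂⟩
    have i₁' : f₁ * f₁ = f₁ := Subtype.ext i₁
    have i₂' : f₂ * f₂ = f₂ := Subtype.ext i₂
    have o' : f₁ * f₂ = 0 := Subtype.ext o
    have s' : σ ⟨b, hc⟩ = f₁ + f₂ := Subtype.ext s
    have s'' : (⟨b, hc⟩ : Subalgebra.center O R) = σ.symm f₁ + σ.symm f₂ := by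
      rw [← map_add, ← s', RingEquiv.symm_apply_apply]
    have := hb.primitive (σ.symm f₁ : R) (σ.symm f₂ : R) (σ.symm f₁).2 (σ.symm f₂).2
      (by rw [← MulMemClass.coe_mul, ← map_mul, i₁']) (by rw [← MulMemClass.coe_mul, ← map_mul, i₂'])
      (by rw [← MulMemClass.coe_mul, ← map_mul, o', map_zero]; rfl) (congrArg Subtype.val s'')
    refine this.imp (fun h => ?_) (fun h => ?_)
    · have h0 : σ.symm f₁ = 0 := Subtype.ext h
      rw [map_eq_zero_iff _ σ.symm.injective] at h0
      exact congrArg Subtype.val h0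
    · have h0 : σ.symm f₂ = 0 := Subtype.ext h
      rw [map_eq_zero_iff _ σ.symm.injective] at h0
      exact congrArg Subtype.val h0

theorem IsBlock.map_equiv {R : Type*} [Ring R] (σ : R ≃+* R) {b : R} (hb : IsBlock b) :
    IsBlock (σ b) := by
  have hcen : ∀ (τ : R ≃+* R) {z : R}, z ∈ Set.center R → τ z ∈ Set.center R := fun τ z hz => by
    rw [Semigroup.mem_center_iff] at hz ⊢
    intro x
    have := congrArg τ (hz (τ.symm x))
    simpa using this
  refine ⟨by rw [← map_mul, hb.idem], hcen σ hb.central, ?_, ?_⟩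
  · rw [Ne, map_eq_zero_iff σ σ.injective]
    exact hb.ne_zero
  · intro e₁ e₂ h₁ h₂ i₁ i₂ o s
    have := hb.primitive (σ.symm e₁) (σ.symm e₂) (hcen _ h₁) (hcen _ h₂) (by rw [← map_mul, i₁])
      (by rw [← map_mul, i₂]) (by rw [← map_mul, o, map_zero])
      (by rw [← map_add, ← s, RingEquiv.symm_apply_apply])
    simpa using this

namespace TwistedSymmetricAlgebra

section BarBlocks

variable {O G A : Type*} [CommRing O] [Group G] [DecidableEq G] [Ring A] [Algebra O A]
  (D : TwistedSymmetricAlgebra O G A)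

/-- A block of `Ā` as an element of `ZĀ`. -/
def BarBlocks.toCenter {D : TwistedSymmetricAlgebra O G A} (b : D.BarBlocks) :
    Subalgebra.center O D.bar :=
  ⟨b.1, b.2.central⟩

/-- A block of `Ā` as an element of `A`. -/
def BarBlocks.val {D : TwistedSymmetricAlgebra O G A} (b : D.BarBlocks) : A :=
  (b.1 : A)

/-- The action of `G` on `Bl(Ā)`, `b ↦ g(b)`. -/
noncomputable instance : MulAction G D.BarBlocks where
  smul g b := ⟨((g • b.toCenter : Subalgebra.center O D.bar) : D.bar),
    b.2.map_center (MulSemiringAction.toRingEquiv G (Subalgebra.center O D.bar) g) b.2.central⟩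
  one_smul b := by
    apply Subtype.ext
    exact congrArg (fun z : Subalgebra.center O D.bar => (z : D.bar)) (one_smul G b.toCenter)
  mul_smul g h b := by
    apply Subtype.ext
    exact congrArg (fun z : Subalgebra.center O D.bar => (z : D.bar)) (mul_smul g h b.toCenter)

end BarBlocks

section Dual

variable {O G A : Type*} [CommRing O] [Group G] [DecidableEq G] [Ring A] [Algebra O A]
  (D : TwistedSymmetricAlgebra O G A)
  {K : Type*} [IsIntegrallyClosed O] [Field K] [Algebra O K] [IsFractionRing O K] [Finite G]

/-- The `O`-linear operator on `A` given by `ξ · a = ξ(g) a` for `a ∈ A_g`. -/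
noncomputable def dualLin (ξ : G →* Kˣ) : A →ₗ[O] A :=
  (DirectSum.toModule O G A fun g => charVal O ξ g • (D.comp g).subtype) ∘ₗ
    ((LinearEquiv.ofBijective (DirectSum.coeLinearMap D.comp) D.internal).symm :
      A →ₗ[O] DirectSum G fun g => D.comp g)

theorem dualLin_apply (ξ : G →* Kˣ) {g : G} {a : A} (ha : a ∈ D.comp g) :
    D.dualLin ξ a = charVal O ξ g • a := by
  have : (LinearEquiv.ofBijective (DirectSum.coeLinearMap D.comp) D.internal).symm a =
      DirectSum.lof O G (fun g => D.comp g) g ⟨a, ha⟩ := by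
    rw [LinearEquiv.symm_apply_eq]
    exact (DirectSum.coeLinearMap_lof D.comp g ⟨a, ha⟩).symm
  simp [dualLin, this, DirectSum.toModule_lof]

theorem dualLin_one_char (a : A) : D.dualLin (1 : G →* Kˣ) a = a := by
  induction a using D.comp_induction with
  | h0 => simp
  | hadd a b ha hb => rw [map_add, ha, hb]
  | hc g a ha => rw [D.dualLin_apply _ ha, charVal_one_char, one_smul]

theorem dualLin_mul_char (ξ ψ : G →* Kˣ) (a : A) :
    D.dualLin (ξ * ψ) a = D.dualLin ξ (D.dualLin ψ a) := by
  induction a using D.comp_induction with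
  | h0 => simp
  | hadd a b ha hb => rw [map_add, map_add, map_add, ha, hb]
  | hc g a ha =>
    rw [D.dualLin_apply _ ha, D.dualLin_apply _ ha, map_smul, D.dualLin_apply _ ha,
      charVal_mul_char, smul_smul, mul_comm]

theorem dualLin_mul (ξ : G →* Kˣ) (a b : A) :
    D.dualLin ξ (a * b) = D.dualLin ξ a * D.dualLin ξ b := by
  induction a using D.comp_induction with
  | h0 => simp
  | hadd a a' ha ha' => rw [add_mul, map_add, map_add, ha, ha', add_mul]
  | hc g a ha =>
    induction b using D.comp_induction with
    | h0 => simp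
    | hadd b b' hb hb' => rw [mul_add, map_add, map_add, hb, hb', mul_add]
    | hc h b hb =>
      rw [D.dualLin_apply _ ha, D.dualLin_apply _ hb, D.dualLin_apply _ (D.mul_mem_comp ha hb),
        charVal_mul, smul_mul_smul_comm]

theorem dualLin_algebraMap (ξ : G →* Kˣ) (r : O) :
    D.dualLin ξ (algebraMap O A r) = algebraMap O A r := by
  rw [D.dualLin_apply ξ ((D.mem_comp_one).2 (D.bar.algebraMap_mem r)), charVal_one, one_smul]

/-- The automorphism `a ↦ ξ · a` of the algebra `A`. -/
noncomputable def dualAct (ξ : G →* Kˣ) : A ≃ₐ[O] A :=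
  AlgEquiv.ofAlgHom
    (AlgHom.ofLinearMap (D.dualLin ξ)
      (by simpa using D.dualLin_algebraMap ξ 1) (D.dualLin_mul ξ))
    (AlgHom.ofLinearMap (D.dualLin ξ⁻¹)
      (by simpa using D.dualLin_algebraMap ξ⁻¹ 1) (D.dualLin_mul ξ⁻¹))
    (by
      ext a
      change D.dualLin ξ (D.dualLin ξ⁻¹ a) = a
      rw [← D.dualLin_mul_char, show ξ * ξ⁻¹ = 1 by ext; simp, D.dualLin_one_char])
    (by
      ext a
      change D.dualLin ξ⁻¹ (D.dualLin ξ a) = a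
      rw [← D.dualLin_mul_char, show ξ⁻¹ * ξ = 1 by ext; simp, D.dualLin_one_char])

variable (K) in
/-- The subalgebra `(ZA)^{G^∨}` of `A`, where `G^∨ = Hom(G, Kˣ)`. -/
def fixedTop : Subalgebra O A where
  carrier := {z | z ∈ Subalgebra.center O A ∧ ∀ ξ : G →* Kˣ, D.dualAct ξ z = z}
  mul_mem' hx hy := ⟨mul_mem hx.1 hy.1, fun ξ => by rw [map_mul, hx.2 ξ, hy.2 ξ]⟩
  add_mem' hx hy := ⟨add_mem hx.1 hy.1, fun ξ => by rw [map_add, hx.2 ξ, hy.2 ξ]⟩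
  algebraMap_mem' r := ⟨Subalgebra.algebraMap_mem _ r, fun ξ => AlgEquiv.commutes _ r⟩

end Dual

/-- `Bl(A)`. (The structure `D` is recorded because the action of `G^∨` depends on it.) -/
def Blocks {O G A : Type*} [CommRing O] [Group G] [DecidableEq G] [Ring A] [Algebra O A]
    (_D : TwistedSymmetricAlgebra O G A) : Type _ :=
  {b : A // IsBlock b}

section Trace

variable {O G A : Type*} [CommRing O] [Group G] [DecidableEq G] [Ring A] [Algebra O A]
  (D : TwistedSymmetricAlgebra O G A)

/-- A block of `A` as an element of `A`. -/
def Blocks.val {D : TwistedSymmetricAlgebra O G A} (b : D.Blocks) : A := b.1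

/-- The action of `G^∨ = Hom(G, Kˣ)` on `Bl(A)`, `b ↦ ξ · b`. -/
noncomputable instance {K : Type*} [IsIntegrallyClosed O] [Field K] [Algebra O K]
    [IsFractionRing O K] [Finite G] : MulAction (G →* Kˣ) D.Blocks where
  smul ξ b := ⟨D.dualAct ξ b.1, b.2.map_equiv (D.dualAct ξ).toRingEquiv⟩
  one_smul b := Subtype.ext (D.dualLin_one_char b.1)
  mul_smul ξ ψ b := Subtype.ext (D.dualLin_mul_char ξ ψ b.1)

/-- `Tr(G, b̄) = ∑_{g ∈ G/G_b̄} g(b̄)`, as an element of `A`. -/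
noncomputable def barTr (b : D.BarBlocks) : A :=
  ∑ᶠ q : G ⧸ MulAction.stabilizer G b, (MulAction.ofQuotientStabilizer G b q).val

variable (K : Type*) [IsIntegrallyClosed O] [Field K] [Algebra O K] [IsFractionRing O K] [Finite G]

/-- `Tr(G^∨, b) = ∑_{ξ ∈ G^∨/(G^∨)_b} ξ · b`. -/
noncomputable def topTr (b : D.Blocks) : A :=
  ∑ᶠ q : (G →* Kˣ) ⧸ MulAction.stabilizer (G →* Kˣ) b,
    (MulAction.ofQuotientStabilizer (G →* Kˣ) b q).val

end Trace

end TwistedSymmetricAlgebra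

/-! Both orbit sets are matched with one third set, the primitive idempotents of a commutative
subalgebra `F` of `A`, where `F = ZA ∩ Ā = (ZA)^{G^∨} = (ZĀ)^G`.

The equality of the three descriptions has two sources. Split semisimplicity of `KG` provides enough
characters to separate the elements of `G`, so `A` being torsion-free forces the fixed points of
`G^∨` on `A` to be `Ā`. On the other side `A_g = Āu` for any unit `u ∈ A_g`, so an element of `ZĀ`
is central in `A` exactly when it is fixed by conjugation by these units, which is how `G` acts on
`ZĀ`.

The rest is a general fact, `exists_orbit_equiv_primitiveIdempotents`: if a finite group acts on a
commutative algebra `Z` with the chain condition, the orbit sums of primitive idempotents of `Z` are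
exactly the primitive idempotents of the fixed algebra. It is applied to `G` on `ZĀ` and to `G^∨` on
`ZA`; both times the fixed algebra is `F`. -/

/-- `e` is a primitive idempotent of the subalgebra `Z`. -/
structure IsPrimitiveIdempotentIn {O R : Type*} [CommRing O] [Ring R] [Algebra O R]
    (Z : Subalgebra O R) (e : R) : Prop where
  mem : e ∈ Z
  idem : e * e = e
  ne_zero : e ≠ 0
  primitive : ∀ e₁ ∈ Z, ∀ e₂ ∈ Z, e₁ * e₁ = e₁ → e₂ * e₂ = e₂ → e₁ * e₂ = 0 → e = e₁ + e₂ →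
    e₁ = 0 ∨ e₂ = 0

/-! ### Primitive idempotents of a commutative subalgebra -/

section PrimitiveIdempotents

variable {O R : Type*} [CommRing O] [Ring R] [Algebra O R] {Z : Subalgebra O R}

/-- The decomposition `b = be + (b - be)` is orthogonal inside `Z`, so primitivity kills one
summand. -/
theorem IsPrimitiveIdempotentIn.mul_eq_zero_or (hZ : ∀ x ∈ Z, ∀ y ∈ Z, x * y = y * x) {b e : R}
    (hb : IsPrimitiveIdempotentIn Z b) (he : e ∈ Z) (hi : e * e = e) :
    b * e = 0 ∨ b * e = b := by
  have hc := hZ b hb.mem e he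
  have h1 : b * e * (b * e) = b * e := by
    rw [mul_assoc, ← mul_assoc e, ← hc, mul_assoc b e e, hi, ← mul_assoc, hb.idem]
  have h2 : b * e * b = b * e := by rw [mul_assoc, ← hc, ← mul_assoc, hb.idem]
  have h3 : b * (b * e) = b * e := by rw [← mul_assoc, hb.idem]
  refine (hb.primitive (b * e) (mul_mem hb.mem he) (b - b * e)
    (sub_mem hb.mem (mul_mem hb.mem he)) h1 ?_ ?_ (by abel)).imp id fun h => (sub_eq_zero.1 h).symm
  · simp only [mul_sub, sub_mul, hb.idem, h1, h2, h3, sub_self, sub_zero]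
  · rw [mul_sub, h1, h2, sub_self]

theorem IsPrimitiveIdempotentIn.mul_eq_zero_of_ne (hZ : ∀ x ∈ Z, ∀ y ∈ Z, x * y = y * x)
    {b c : R} (hb : IsPrimitiveIdempotentIn Z b) (hc : IsPrimitiveIdempotentIn Z c)
    (hne : b ≠ c) : b * c = 0 := by
  rcases hb.mul_eq_zero_or hZ hc.mem hc.idem with h | h
  · exact h
  · rcases hc.mul_eq_zero_or hZ hb.mem hb.idem with h' | h'
    · rw [hZ b hb.mem c hc.mem, h']
    · exact absurd (by rw [← h, hZ b hb.mem c hc.mem, h']) hne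

theorem exists_isPrimitiveIdempotentIn_mul_eq [IsNoetherian O R]
    (hZ : ∀ x ∈ Z, ∀ y ∈ Z, x * y = y * x) {e : R} (he : e ∈ Z) (hi : e * e = e) (h0 : e ≠ 0) :
    ∃ b, IsPrimitiveIdempotentIn Z b ∧ b * e = b := by
  let S : Set R := {f | f ∈ Z ∧ f * f = f ∧ f ≠ 0 ∧ f * e = f}
  -- Noetherianity gives a nonzero idempotent `f` below `e` whose left annihilator `{x | x * f = 0}`
  -- is maximal; a proper splitting of `f` would enlarge it.
  obtain ⟨f, ⟨hfZ, hfi, hf0, hfe⟩, hmax⟩ : ∃ f ∈ S, ∀ f' ∈ S,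
      ¬ LinearMap.ker (LinearMap.mulRight O f) < LinearMap.ker (LinearMap.mulRight O f') := by
    obtain ⟨N, ⟨f, hf, rfl⟩, hN⟩ := WellFounded.has_min (wellFounded_gt (α := Submodule O R))
      ((fun f => LinearMap.ker (LinearMap.mulRight O f)) '' S) ⟨_, e, ⟨he, hi, h0, hi⟩, rfl⟩
    exact ⟨f, hf, fun f' hf' => hN _ ⟨f', hf', rfl⟩⟩
  refine ⟨f, ⟨hfZ, hfi, hf0, fun e₁ h₁ e₂ h₂ i₁ i₂ o s => ?_⟩, hfe⟩
  by_contra! hne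
  have h : f * e₁ = e₁ := by rw [s, add_mul, i₁, hZ e₂ h₂ e₁ h₁, o, add_zero]
  refine hmax e₁ ⟨h₁, i₁, hne.1, ?_⟩ (lt_of_le_of_ne (fun x hx => ?_) fun heq => ?_)
  · rw [← h, hZ f hfZ e₁ h₁, mul_assoc, hfe]
  · rw [LinearMap.mem_ker, LinearMap.mulRight_apply] at hx ⊢
    rw [← h, ← mul_assoc, hx, zero_mul]
  -- `1 - e₁` annihilates `e₁`; if the annihilators agreed it would also annihilate `f`, giving `e₂
  -- = f - e₁ = 0`.
  · have hmem : 1 - e₁ ∈ LinearMap.ker (LinearMap.mulRight O f) := by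
      rw [heq, LinearMap.mem_ker, LinearMap.mulRight_apply, sub_mul, one_mul, i₁, sub_self]
    rw [LinearMap.mem_ker, LinearMap.mulRight_apply, sub_mul, one_mul, hZ e₁ h₁ f hfZ, h, s,
      add_sub_cancel_left] at hmem
    exact hne.2 hmem

end PrimitiveIdempotents

/-! ### Orbit sums and fixed algebras -/

section OrbitSums

variable {O R H P : Type*} [CommRing O] [Ring R] [Algebra O R] [Group H] [MulAction H P]

theorem finsum_mem_orbit_smul (v : P → R) (Y : MulAction.orbitRel.Quotient H P) (h : H) :
    ∑ᶠ b ∈ Y.orbit, v (h • b) = ∑ᶠ b ∈ Y.orbit, v b := by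
  refine finsum_mem_eq_of_bijOn (h • ·) ⟨Y.mapsTo_smul_orbit h, (MulAction.injective h).injOn,
    fun b hb => ⟨h⁻¹ • b, Y.mapsTo_smul_orbit h⁻¹ hb, smul_inv_smul h b⟩⟩ fun _ _ => rfl

/-- Orbit-stabilizer: a trace over cosets of the stabilizer is the sum over the orbit, hence the
same for every point of the orbit. -/
theorem finsum_ofQuotientStabilizer (v : P → R) (Y : MulAction.orbitRel.Quotient H P) {b : P}
    (hb : b ∈ Y.orbit) :
    ∑ᶠ q : H ⧸ MulAction.stabilizer H b, v (MulAction.ofQuotientStabilizer H b q) =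
      ∑ᶠ c ∈ Y.orbit, v c := by
  obtain rfl := MulAction.orbitRel.Quotient.mem_orbit.1 hb
  rw [MulAction.orbitRel.Quotient.orbit_mk, ← finsum_mem_univ]
  refine finsum_mem_eq_of_bijOn (MulAction.ofQuotientStabilizer H b)
    ⟨fun q _ => MulAction.ofQuotientStabilizer_mem_orbit H b q,
      (MulAction.injective_ofQuotientStabilizer H b).injOn, ?_⟩ fun _ _ => rfl
  rintro _ ⟨h, rfl⟩
  exact ⟨h, trivial, MulAction.ofQuotientStabilizer_mk H b h⟩

theorem finite_orbitRelQuotient_orbit [Finite H] (Y : MulAction.orbitRel.Quotient H P) :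
    Y.orbit.Finite := by
  induction Y using Quotient.inductionOn' with
  | h b => exact Set.finite_range _

/-- Let `v` enumerate the primitive idempotents of the commutative algebra `Z`, and let `F` be
the algebra of fixed points of `H` on `Z`. The orbit sums are the primitive idempotents of `F`. -/
theorem exists_orbit_equiv_primitiveIdempotents [IsNoetherian O R] [Finite H]
    {Z F : Subalgebra O R} (hZ : ∀ x ∈ Z, ∀ y ∈ Z, x * y = y * x) {v : P → R}
    (hv : Function.Injective v) (hP : ∀ e, IsPrimitiveIdempotentIn Z e ↔ ∃ b, v b = e)
    (σ : H → R →+* R) (hσ : ∀ h b, v (h • b) = σ h (v b))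
    (hF : ∀ e, e ∈ F ↔ e ∈ Z ∧ ∀ h, σ h e = e) :
    ∃ Ψ : MulAction.orbitRel.Quotient H P ≃ {e : R // IsPrimitiveIdempotentIn F e},
      ∀ Y, (Ψ Y : R) = ∑ᶠ b ∈ Y.orbit, v b := by
  have hprim : ∀ b, IsPrimitiveIdempotentIn Z (v b) := fun b => (hP _).2 ⟨b, rfl⟩
  let s : MulAction.orbitRel.Quotient H P → R := fun Y => ∑ᶠ b ∈ Y.orbit, v b
  have hs_def : ∀ Y, s Y = ∑ᶠ b ∈ Y.orbit, v b := fun _ => rfl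
  have hfin : ∀ Y : MulAction.orbitRel.Quotient H P, Y.orbit.Finite :=
    finite_orbitRelQuotient_orbit
  have hmul : ∀ (b : P) (Y : MulAction.orbitRel.Quotient H P), b ∈ Y.orbit →
      v b * s Y = v b := fun b Y hb => by
    rw [hs_def, mul_finsum_mem' _ _ (hfin Y), finsum_eq_single _ b fun c hne => ?_]
    · simp only [hb, finsum_true, (hprim b).idem]
    · rw [(hprim b).mul_eq_zero_of_ne hZ (hprim c) fun h => hne (hv h).symm, finsum_zero]
  have hsF : ∀ Y, s Y ∈ F := fun Y => by
    refine (hF _).2 ⟨finsum_mem_induction (· ∈ Z) (zero_mem Z) (fun _ _ => add_mem)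
      fun b _ => (hprim b).mem, fun h => ?_⟩
    have := (σ h).toAddMonoidHom.map_finsum_mem v (hfin Y)
    change σ h (s Y) = ∑ᶠ b ∈ Y.orbit, σ h (v b) at this
    simp_rw [this, ← hσ]
    exact finsum_mem_orbit_smul v Y h
  have hsmul : ∀ (Y : MulAction.orbitRel.Quotient H P) (x : R),
      (∀ b ∈ Y.orbit, v b * x = v b) → s Y * x = s Y := fun Y x hx => by
    rw [hs_def, finsum_mem_mul' _ _ (hfin Y)]
    exact finsum_mem_congr rfl hx
  have hsi : ∀ Y, s Y * s Y = s Y := fun Y => hsmul Y _ fun b hb => hmul b Y hb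
  have hs0 : ∀ Y, s Y ≠ 0 := fun Y h => by
    obtain ⟨b, hb⟩ := Y.nonempty_orbit
    have := hmul b Y hb
    rw [h, mul_zero] at this
    exact (hprim b).ne_zero this.symm
  -- Since `e` is fixed by every `σ h`, the relation `v b * e = v b` is carried along the whole
  -- orbit of `b`.
  have hspread : ∀ (b : P) (Y : MulAction.orbitRel.Quotient H P), b ∈ Y.orbit → ∀ e ∈ F,
      v b * e = v b → s Y * e = s Y := fun b Y hb e he hbe => hsmul Y e fun c hc => by
    obtain rfl := MulAction.orbitRel.Quotient.mem_orbit.1 hb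
    obtain ⟨h, rfl⟩ := hc
    change v (h • b) * e = v (h • b)
    rw [hσ, ← ((hF e).1 he).2 h, ← map_mul, hbe]
  have hFZ : ∀ e ∈ F, e ∈ Z := fun e he => ((hF e).1 he).1
  have hsp : ∀ Y, IsPrimitiveIdempotentIn F (s Y) := fun Y => by
    refine ⟨hsF Y, hsi Y, hs0 Y, fun e₁ h₁ e₂ h₂ i₁ i₂ o hs => ?_⟩
    obtain ⟨b, hb⟩ := Y.nonempty_orbit
    have hse₁ : s Y * e₁ = e₁ := by
      rw [hs, add_mul, i₁, hZ e₂ (hFZ _ h₂) e₁ (hFZ _ h₁), o, add_zero]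
    -- A single `b` in the orbit decides which summand vanishes: it lies under `1 - e₁` or under
    -- `e₁`, and by `hspread` so does all of `s Y`.
    rcases (hprim b).mul_eq_zero_or hZ (hFZ _ h₁) i₁ with h | h
    · left
      have := hspread b Y hb (1 - e₁) (sub_mem (one_mem F) h₁)
        (by rw [mul_sub, h, mul_one, sub_zero])
      rwa [mul_sub, mul_one, sub_eq_self, hse₁] at this
    · right
      have := hspread b Y hb e₁ h₁ h
      rw [hse₁, hs] at this
      exact left_eq_add.1 this
  refine ⟨Equiv.ofBijective (fun Y => ⟨s Y, hsp Y⟩) ⟨fun Y Y' h => ?_, fun e => ?_⟩,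
    fun Y => rfl⟩
  -- Injectivity: `v b` is orthogonal to the sum over any orbit not containing `b`, but is fixed by
  -- multiplication by `s Y`.
  · have h' : s Y = s Y' := congrArg Subtype.val h
    obtain ⟨b, hb⟩ := Y.nonempty_orbit
    by_contra hne
    refine (hprim b).ne_zero ?_
    rw [← hmul b Y hb, h', hs_def, mul_finsum_mem' _ _ (hfin Y')]
    refine finsum_mem_eq_zero_of_forall_eq_zero fun c hc => ?_
    refine (hprim b).mul_eq_zero_of_ne hZ (hprim c) fun hbc => hne ?_
    rw [← MulAction.orbitRel.Quotient.mem_orbit.1 hb, hv hbc,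
      MulAction.orbitRel.Quotient.mem_orbit.1 hc]
  -- Surjectivity: choose a primitive idempotent `v b` of `Z` under `e`. Its orbit sum is then under
  -- `e` and nonzero, so it equals `e` by primitivity of `e` in `F`.
  · obtain ⟨e, he⟩ := e
    obtain ⟨_, hb, hbe⟩ := exists_isPrimitiveIdempotentIn_mul_eq hZ (hFZ e he.mem) he.idem
      he.ne_zero
    obtain ⟨b, rfl⟩ := (hP _).1 hb
    let Y : MulAction.orbitRel.Quotient H P := Quotient.mk'' b
    have hbY : b ∈ Y.orbit := MulAction.orbitRel.Quotient.mem_orbit.2 rfl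
    refine ⟨Y, Subtype.ext ?_⟩
    have hse : s Y * e = s Y := hspread b Y hbY e he.mem hbe
    have hcomm := hZ _ (hFZ _ (hsF Y)) e (hFZ _ he.mem)
    have := he.mul_eq_zero_or (fun x hx y hy => hZ x (hFZ x hx) y (hFZ y hy)) (hsF Y) (hsi Y)
    rw [← hcomm, hse] at this
    exact this.resolve_left (hs0 Y)

end OrbitSums

/-! ### Split semisimplicity and separation by characters -/

/-- The Jacobson radical vanishes, so `x` avoids some maximal ideal `m`. As `B` is commutative it
acts on `B ⧸ m` by `B`-linear endomorphisms, and splitness identifies these with `K`. -/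
theorem IsSplitSemisimple.exists_algHom_ne_zero {K B : Type*} [Field K] [CommRing B] [Algebra K B]
    (h : IsSplitSemisimple K B) {x : B} (hx : x ≠ 0) : ∃ φ : B →ₐ[K] K, φ x ≠ 0 := by
  have := h.1
  have hj : x ∉ Ring.jacobson B := by
    rw [IsSemisimpleRing.jacobson_eq_bot]
    exact hx
  obtain ⟨m, hm, hxm⟩ : ∃ m : Ideal B, m.IsMaximal ∧ x ∉ m := by
    rw [Ring.jacobson_eq_sInf_isMaximal, Submodule.mem_sInf] at hj
    push Not at hj
    exact hj
  have : IsSimpleModule B (B ⧸ m) := isSimpleModule_iff_isCoatom.2 hm.out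
  obtain ⟨ε⟩ := h.2 (B ⧸ m)
  refine ⟨(ε : Module.End B (B ⧸ m) →ₐ[K] K).comp (Algebra.lsmul K B (B ⧸ m)), fun h0 => ?_⟩
  have h1 : Algebra.lsmul K B (B ⧸ m) x = 0 := ε.injective (h0.trans (map_zero ε).symm)
  have h2 : Ideal.Quotient.mk m x = 0 := by
    simpa [Algebra.smul_def] using congrArg (fun f : Module.End B (B ⧸ m) => f 1) h1
  exact hxm (Ideal.Quotient.eq_zero_iff_mem.1 h2)

/-- A `K`-algebra map `KG → K` not killing `g - 1` restricts on `G` to a character nontrivial at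
`g`. -/
theorem exists_monoidHom_ne_one {K G : Type*} [Field K] [Group G] [IsCyclic G]
    (hG : IsSplitSemisimple K (MonoidAlgebra K G)) {g : G} (hg : g ≠ 1) :
    ∃ ξ : G →* Kˣ, ξ g ≠ 1 := by
  let : CommGroup G := IsCyclic.commGroup
  have hx : MonoidAlgebra.of K G g - 1 ≠ 0 := by
    rw [sub_ne_zero, ← map_one (MonoidAlgebra.of K G)]
    exact fun h => hg (MonoidAlgebra.of_injective h)
  obtain ⟨φ, hφ⟩ := IsSplitSemisimple.exists_algHom_ne_zero (B := MonoidAlgebra K G) hG hx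
  refine ⟨((φ : MonoidAlgebra K G →* K).comp (MonoidAlgebra.of K G)).toHomUnits, fun h => hφ ?_⟩
  have := congrArg Units.val h
  rw [MonoidHom.coe_toHomUnits] at this
  rw [map_sub, map_one, sub_eq_zero]
  exact this

/-- Places blocks of different rings inside one ambient algebra. It serves for `Ā`, `A` and the two
fixed algebras, each embedded in `A`. -/
theorem isPrimitiveIdempotentIn_iff_exists_isBlock {O R S : Type*} [CommRing O] [Ring R]
    [Algebra O R] [Semiring S] (ι : S →+* R) (hι : Function.Injective ι) {F : Subalgebra O R}
    (hF : ∀ x, x ∈ F ↔ ∃ s ∈ Set.center S, ι s = x) (e : R) :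
    IsPrimitiveIdempotentIn F e ↔ ∃ s, IsBlock s ∧ ι s = e := by
  constructor
  · intro h
    obtain ⟨s, hs, rfl⟩ := (hF e).1 h.mem
    refine ⟨s, ⟨hι (by rw [map_mul, h.idem]), hs, fun h0 => h.ne_zero (by rw [h0, map_zero]),
      fun e₁ e₂ c₁ c₂ i₁ i₂ o d => ?_⟩, rfl⟩
    have := h.primitive (ι e₁) ((hF _).2 ⟨e₁, c₁, rfl⟩) (ι e₂) ((hF _).2 ⟨e₂, c₂, rfl⟩)
      (by rw [← map_mul, i₁]) (by rw [← map_mul, i₂]) (by rw [← map_mul, o, map_zero])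
      (by rw [d, map_add])
    simpa only [map_eq_zero_iff ι hι] using this
  · rintro ⟨s, h, rfl⟩
    refine ⟨(hF _).2 ⟨s, h.central, rfl⟩, by rw [← map_mul, h.idem],
      (map_ne_zero_iff ι hι).2 h.ne_zero, fun e₁ h₁ e₂ h₂ i₁ i₂ o d => ?_⟩
    obtain ⟨s₁, c₁, rfl⟩ := (hF _).1 h₁
    obtain ⟨s₂, c₂, rfl⟩ := (hF _).1 h₂
    have := h.primitive s₁ s₂ c₁ c₂ (hι (by rw [map_mul, i₁])) (hι (by rw [map_mul, i₂]))
      (hι (by rw [map_mul, o, map_zero])) (hι (by rw [d, map_add]))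
    simpa only [map_eq_zero_iff ι hι] using this

/-! ### The action of `G` on `ZĀ` as conjugation in `A` -/

namespace TwistedSymmetricAlgebra

variable {O G A : Type*} [CommRing O] [Group G] [DecidableEq G] [Ring A] [Algebra O A]
  (D : TwistedSymmetricAlgebra O G A)

/-- The center of `Ā`, as a subalgebra of `A`. -/
def barCenter : Subalgebra O A :=
  (Subalgebra.center O D.bar).map D.bar.val

theorem mem_barCenter {a : A} : a ∈ D.barCenter ↔ ∃ z ∈ Set.center D.bar, D.bar.val z = a :=
  Iff.rfl

theorem mul_comm_of_mem_barCenter {a b : A} (ha : a ∈ D.barCenter) (hb : b ∈ D.bar) :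
    a * b = b * a := by
  obtain ⟨z, hz, rfl⟩ := ha
  exact (congrArg Subtype.val (Subalgebra.mem_center_iff.1 hz ⟨b, hb⟩)).symm

theorem barCenter_le_bar {a : A} (ha : a ∈ D.barCenter) : a ∈ D.bar := by
  obtain ⟨z, -, rfl⟩ := ha
  exact z.2

/-- Conjugation by a unit in `A_g`. -/
noncomputable def conj (g : G) : A →+* A :=
  MulSemiringAction.toRingHom (ConjAct Aˣ) A (ConjAct.toConjAct (D.exists_unit g).choose)

theorem conj_apply (g : G) (a : A) :
    D.conj g a = (D.exists_unit g).choose * a * ((D.exists_unit g).choose⁻¹ : Aˣ) :=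
  ConjAct.units_smul_def _ _

/-- The defining relation `g(z) x = x z`, read at the chosen unit `x ∈ A_g`. The units are chosen
independently, so `conj` need not be multiplicative in `g`; the orbit-sum argument only needs this
compatibility. -/
theorem coe_smul_center (g : G) (z : Subalgebra.center O D.bar) :
    (((g • z : Subalgebra.center O D.bar) : D.bar) : A) = D.conj g ((z : D.bar) : A) := by
  rw [conj_apply, Units.eq_mul_inv_iff_mul_eq]
  exact D.act_mul z (D.exists_unit g).choose_spec

/-- Every `x ∈ A_g` factors as `(x u⁻¹) u` with `x u⁻¹ ∈ Ā`. Since `a` already commutes with `Ā`,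
commuting with `x` reduces to commuting with `u`. -/
theorem mem_center_iff_conj {a : A} (ha : a ∈ D.barCenter) :
    a ∈ Subalgebra.center O A ↔ ∀ g, D.conj g a = a := by
  constructor
  · intro h g
    rw [conj_apply, Subalgebra.mem_center_iff.1 h, mul_assoc, Units.mul_inv, mul_one]
  · intro h
    refine Subalgebra.mem_center_iff.2 fun x => ?_
    induction x using D.comp_induction with
    | h0 => simp
    | hadd x y hx hy => rw [add_mul, mul_add, hx, hy]
    | hc g x hx =>
      have hu := (D.exists_unit g).choose_spec
      have hg := h g
      rw [conj_apply] at hg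
      set u := (D.exists_unit g).choose
      have hxu : x * (u⁻¹ : Aˣ) ∈ D.bar := by
        rw [← D.mem_comp_one]
        simpa using D.mul_mem_comp hx (D.inv_mem_comp hu)
      have hau : (u : A) * a = a * u := by rw [← Units.mul_inv_eq_iff_eq_mul, hg]
      calc x * a = x * (u⁻¹ : Aˣ) * (u * a) := by simp [mul_assoc]
        _ = a * (x * (u⁻¹ : Aˣ)) * u := by
          rw [hau, ← mul_assoc, ← D.mul_comm_of_mem_barCenter ha hxu]
        _ = a * x := by simp [mul_assoc]

/-! ### The action of `G^∨` and the common fixed algebra -/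

variable {K : Type*} [IsIntegrallyClosed O] [Field K] [Algebra O K] [IsFractionRing O K] [Finite G]

theorem component_dualLin (ξ : G →* Kˣ) (a : A) (g : G) :
    (LinearEquiv.ofBijective (DirectSum.coeLinearMap D.comp) D.internal).symm (D.dualLin ξ a) g =
      charVal O ξ g •
        (LinearEquiv.ofBijective (DirectSum.coeLinearMap D.comp) D.internal).symm a g := by
  induction a using D.comp_induction with
  | h0 => simp
  | hadd a b ha hb => simp only [map_add, DirectSum.add_apply, ha, hb, smul_add]
  | hc h a ha =>
    have : (LinearEquiv.ofBijective (DirectSum.coeLinearMap D.comp) D.internal).symm a =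
        DirectSum.lof O G (fun g => D.comp g) h ⟨a, ha⟩ := by
      rw [LinearEquiv.symm_apply_eq]
      exact (DirectSum.coeLinearMap_lof D.comp h ⟨a, ha⟩).symm
    rw [D.dualLin_apply ξ ha, map_smul, DirectSum.smul_apply, this]
    by_cases hgh : h = g
    · subst hgh
      rfl
    · rw [DirectSum.lof_eq_of, DirectSum.of_eq_of_ne _ _ _ (Ne.symm hgh), smul_zero, smul_zero]

/-- Comparing components in `ξ · a = a` gives `(ξ(g) - 1) a_g = 0`. For `g ≠ 1` some `ξ` makes the
scalar nonzero, and torsion-freeness gives `a_g = 0`. -/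
theorem forall_dualAct_eq_iff [IsDomain O] [Module.IsTorsionFree O A]
    (hsep : ∀ g : G, g ≠ 1 → ∃ ξ : G →* Kˣ, ξ g ≠ 1) {a : A} :
    (∀ ξ : G →* Kˣ, D.dualAct ξ a = a) ↔ a ∈ D.bar := by
  constructor
  · intro h
    set π := (LinearEquiv.ofBijective (DirectSum.coeLinearMap D.comp) D.internal).symm with hπ
    have h0 : ∀ g, g ≠ 1 → π a g = 0 := fun g hg => by
      obtain ⟨ξ, hξ⟩ := hsep g hg
      have h1 : π a g = charVal O ξ g • π a g := by
        conv_lhs => rw [← h ξ]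
        exact D.component_dualLin ξ a g
      have h2 : (charVal O ξ g - 1) • (π a g : A) = 0 := by
        rw [sub_smul, one_smul, ← Submodule.coe_smul, ← h1, sub_self]
      refine Subtype.ext ((smul_eq_zero.1 h2).resolve_left fun h3 => hξ ?_)
      have := algebraMap_charVal (O := O) ξ g
      rw [sub_eq_zero.1 h3, map_one] at this
      exact Units.ext this.symm
    have h1 : π a = DirectSum.lof O G (fun g => D.comp g) 1 (π a 1) := by
      ext g
      by_cases hg : g = 1
      · subst hg
        rw [DirectSum.lof_apply]
      · rw [h0 g hg, DirectSum.lof_eq_of, DirectSum.of_eq_of_ne _ _ _ hg]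
    rw [← D.mem_comp_one]
    have h2 := π.symm_apply_apply a
    rw [h1] at h2
    have h3 := DirectSum.coeLinearMap_lof D.comp 1 (π a 1)
    rw [← h2]
    change DirectSum.coeLinearMap D.comp _ ∈ _
    rw [h3]
    exact (π a 1).2
  · intro h ξ
    change D.dualLin ξ a = a
    rw [D.dualLin_apply ξ (D.mem_comp_one.2 h), charVal_one, one_smul]

/-- The pivot of the proof: `(ZA)^{G^∨} = ZA ∩ Ā = (ZĀ)^G` inside `A`, so both group actions have
the same fixed algebra. -/
theorem mem_fixedTop_iff [IsDomain O] [Module.IsTorsionFree O A]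
    (hsep : ∀ g : G, g ≠ 1 → ∃ ξ : G →* Kˣ, ξ g ≠ 1) {a : A} :
    a ∈ D.fixedTop K ↔ a ∈ D.barCenter ∧ ∀ g, D.conj g a = a := by
  have h : a ∈ D.fixedTop K ↔ a ∈ Subalgebra.center O A ∧ a ∈ D.bar :=
    and_congr_right fun _ => D.forall_dualAct_eq_iff hsep
  rw [h]
  constructor
  · rintro ⟨hc, hb⟩
    have hbc : a ∈ D.barCenter := D.mem_barCenter.2 ⟨⟨a, hb⟩,
      (Subalgebra.mem_center_iff (R := O)).2 fun w => Subtype.ext (Subalgebra.mem_center_iff.1 hc w), rfl⟩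
    exact ⟨hbc, (D.mem_center_iff_conj hbc).1 hc⟩
  · rintro ⟨hbc, hg⟩
    exact ⟨(D.mem_center_iff_conj hbc).2 hg, D.barCenter_le_bar hbc⟩

theorem mem_fixedBar_iff [IsDomain O] [Module.IsTorsionFree O A]
    (hsep : ∀ g : G, g ≠ 1 → ∃ ξ : G →* Kˣ, ξ g ≠ 1) {z : Subalgebra.center O D.bar} :
    z ∈ D.fixedBar ↔ ((z : D.bar) : A) ∈ D.fixedTop K := by
  rw [D.mem_fixedTop_iff hsep]
  have hz : ((z : D.bar) : A) ∈ D.barCenter := D.mem_barCenter.2 ⟨z, z.2, rfl⟩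
  refine Iff.trans (forall_congr' fun g => ?_) (and_iff_right hz).symm
  rw [← coe_smul_center]
  exact ⟨fun h => by rw [h], fun h => Subtype.ext (Subtype.ext h)⟩

theorem image_isBlock_fixedBar [IsDomain O] [Module.IsTorsionFree O A]
    (hsep : ∀ g : G, g ≠ 1 → ∃ ξ : G →* Kˣ, ξ g ≠ 1) :
    (fun z : D.fixedBar => (((z : Subalgebra.center O D.bar) : D.bar) : A)) '' {z | IsBlock z} =
      {e | IsPrimitiveIdempotentIn (D.fixedTop K) e} := by
  ext e
  let ι : D.fixedBar →+* A := (D.bar.val.toRingHom.comp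
    (Subalgebra.center O D.bar).val.toRingHom).comp D.fixedBar.val.toRingHom
  have hι : Function.Injective ι := fun x y h => Subtype.ext (Subtype.ext (Subtype.ext h))
  refine (isPrimitiveIdempotentIn_iff_exists_isBlock ι hι (fun x => ⟨fun hx => ?_, ?_⟩) e).symm
  · obtain ⟨z, hz, rfl⟩ := D.mem_barCenter.1 ((D.mem_fixedTop_iff hsep).1 hx).1
    exact ⟨⟨⟨z, hz⟩, (D.mem_fixedBar_iff hsep).2 hx⟩, by simp, rfl⟩
  · rintro ⟨z, -, rfl⟩
    exact (D.mem_fixedBar_iff hsep).1 z.2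

theorem image_isBlock_fixedTop :
    (fun z : D.fixedTop K => (z : A)) '' {z | IsBlock z} =
      {e | IsPrimitiveIdempotentIn (D.fixedTop K) e} := by
  ext e
  refine (isPrimitiveIdempotentIn_iff_exists_isBlock (D.fixedTop K).val.toRingHom
    Subtype.val_injective (fun x => ⟨fun hx => ⟨⟨x, hx⟩, ?_, rfl⟩, ?_⟩) e).symm
  · rw [Semigroup.mem_center_iff]
    exact fun y => Subtype.ext (Subalgebra.mem_center_iff.1 hx.1 y)
  · rintro ⟨z, -, rfl⟩
    exact z.2

/-! ### Both orbit sets as primitive idempotents of the common fixed algebra -/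

theorem exists_barOrbit_equiv [IsDomain O] [Module.IsTorsionFree O A] [IsNoetherian O A]
    (hsep : ∀ g : G, g ≠ 1 → ∃ ξ : G →* Kˣ, ξ g ≠ 1) :
    ∃ Ψ : MulAction.orbitRel.Quotient G D.BarBlocks ≃
        {e : A // IsPrimitiveIdempotentIn (D.fixedTop K) e},
      ∀ Y, (Ψ Y : A) = ∑ᶠ b ∈ Y.orbit, b.val := by
  refine exists_orbit_equiv_primitiveIdempotents (Z := D.barCenter)
    (fun x hx y hy => D.mul_comm_of_mem_barCenter hx (D.barCenter_le_bar hy))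
    (fun b c h => Subtype.ext (Subtype.ext h)) (fun e => ?_) D.conj
    (fun g b => D.coe_smul_center g b.toCenter) (fun e => D.mem_fixedTop_iff hsep)
  refine (isPrimitiveIdempotentIn_iff_exists_isBlock D.bar.val.toRingHom
    Subtype.val_injective (fun x => D.mem_barCenter) e).trans ?_
  exact ⟨fun ⟨s, hs, h⟩ => ⟨⟨s, hs⟩, h⟩, fun ⟨b, h⟩ => ⟨b.1, b.2, h⟩⟩

theorem exists_topOrbit_equiv [IsNoetherian O A] :
    ∃ Ψ : MulAction.orbitRel.Quotient (G →* Kˣ) D.Blocks ≃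
        {e : A // IsPrimitiveIdempotentIn (D.fixedTop K) e},
      ∀ Y, (Ψ Y : A) = ∑ᶠ b ∈ Y.orbit, b.val := by
  refine exists_orbit_equiv_primitiveIdempotents (Z := Subalgebra.center O A)
    (fun x _ y hy => Subalgebra.mem_center_iff.1 hy x)
    (fun b c h => Subtype.ext h) (fun e => ?_) (fun ξ => ((D.dualAct ξ : A →ₐ[O] A) : A →+* A))
    (fun ξ b => rfl) (fun e => Iff.rfl)
  refine (isPrimitiveIdempotentIn_iff_exists_isBlock (RingHom.id A)
    Function.injective_id (fun x => ?_) e).trans ?_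
  · exact ⟨fun hx => ⟨x, hx, rfl⟩, fun ⟨_, hs, h⟩ => h ▸ hs⟩
  · exact ⟨fun ⟨s, hs, h⟩ => ⟨⟨s, hs⟩, h⟩, fun ⟨b, h⟩ => ⟨b.1, b.2, h⟩⟩

end TwistedSymmetricAlgebra

/-! ### The main theorem -/

theorem mainTheorem9 {O K G A : Type*}
    [CommRing O] [IsDomain O] [IsNoetherianRing O] [IsIntegrallyClosed O]
    [Field K] [Algebra O K] [IsFractionRing O K]
    [Group G] [DecidableEq G] [Finite G] [IsCyclic G]
    [Ring A] [Algebra O A] [Module.Free O A] [Module.Finite O A]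
    (D : TwistedSymmetricAlgebra O G A)
    (hA : IsSplitSemisimple K (K ⊗[O] A))
    (hbar : IsSplitSemisimple K (K ⊗[O] D.bar))
    (hG : IsSplitSemisimple K (MonoidAlgebra K G)) :
    (∃ Φ : MulAction.orbitRel.Quotient G D.BarBlocks ≃
          MulAction.orbitRel.Quotient (G →* Kˣ) D.Blocks,
      ∀ Y : MulAction.orbitRel.Quotient G D.BarBlocks,
        (∑ᶠ b ∈ Y.orbit, b.val) = (∑ᶠ b ∈ (Φ Y).orbit, b.val) ∧
        ∀ b' ∈ Y.orbit, ∀ b ∈ (Φ Y).orbit, D.barTr b' = D.topTr K b) ∧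
    (fun z : D.fixedBar => (((z : Subalgebra.center O D.bar) : D.bar) : A)) '' {z | IsBlock z} =
      (fun z : D.fixedTop K => (z : A)) '' {z | IsBlock z} ∧
    ((∀ (ξ : G →* Kˣ) (b : D.Blocks), ξ • b = b) →
      {b : A | IsBlock b} =
        (fun z : D.fixedBar => (((z : Subalgebra.center O D.bar) : D.bar) : A)) ''
          {z | IsBlock z}) := by
  have hsep : ∀ g : G, g ≠ 1 → ∃ ξ : G →* Kˣ, ξ g ≠ 1 := fun g hg => exists_monoidHom_ne_one hG hg
  obtain ⟨Ψ, hΨ⟩ := D.exists_barOrbit_equiv hsep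
  obtain ⟨Θ, hΘ⟩ := D.exists_topOrbit_equiv (K := K)
  refine ⟨⟨Ψ.trans Θ.symm, fun Y => ?_⟩, ?_, fun hfix => ?_⟩
  · have h : (∑ᶠ b ∈ Y.orbit, b.val) = ∑ᶠ b ∈ ((Ψ.trans Θ.symm) Y).orbit, b.val := by
      rw [← hΨ, ← hΘ, Equiv.trans_apply, Equiv.apply_symm_apply]
    refine ⟨h, fun b' hb' b hb => ?_⟩
    exact (finsum_ofQuotientStabilizer TwistedSymmetricAlgebra.BarBlocks.val Y hb').trans
      (h.trans (finsum_ofQuotientStabilizer TwistedSymmetricAlgebra.Blocks.val _ hb).symm)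
  · rw [D.image_isBlock_fixedBar hsep, D.image_isBlock_fixedTop]
  · rw [D.image_isBlock_fixedBar hsep]
    -- When `G^∨` fixes every block its orbits are singletons, so each orbit sum is the block itself
    -- and `Θ` identifies `Bl(A)` with the primitive idempotents of the fixed algebra.
    have hΘ' : ∀ b : D.Blocks, (Θ (Quotient.mk'' b) : A) = b.val := fun b => by
      rw [hΘ, MulAction.orbitRel.Quotient.orbit_mk, show MulAction.orbit (G →* Kˣ) b = {b} from
        Set.eq_singleton_iff_unique_mem.2
          ⟨MulAction.mem_orbit_self b, fun _ ⟨ξ, h⟩ => h ▸ hfix ξ b⟩, finsum_mem_singleton]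
    ext e
    constructor
    · intro he
      let b : D.Blocks := ⟨e, he⟩
      have := (Θ (Quotient.mk'' b)).2
      rwa [hΘ'] at this
    · intro he
      obtain ⟨Y, hY⟩ := Θ.surjective ⟨e, he⟩
      obtain ⟨b, rfl⟩ := Quotient.exists_rep Y
      have := (hΘ' b).symm.trans (congrArg Subtype.val hY)
      change b.1 = e at this
      exact this ▸ b.2
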